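/- Let $\Delta=\{(\beta,\alpha)\in\mathbb{R}^2:\ \beta\in(1,2),\ \alpha\in[0,2-\beta]\}$. For $(\beta,\alpha)\in\Delta$ let $T=T_{\beta,\alpha}:[0,1]\to[0,1]$, $T(x)=\beta x+\alpha \bmod 1$, and $p=(1-\alpha)/\beta$. The upper expansion of $x\in[0,1)$ is the word $\tau^+(x)=\omega_1\omega_2\cdots\in\{0,1\}^{\mathbb{N}}$ with $\omega_n=0$ if $T^{n-1}(x)<p$ and $\omega_n=1$ otherwise, and the lower expansion of $x\in(0,1]$ is $\tau^-(x)=\lim_{y\nearrow x}\tau^+(y)$. Equivalently, $\tau^-(x)=\omega_1\omega_2\cdots$ with $\omega_n=0$ if $(T^-)^{n-1}(x)\le p$ and $\omega_n=1$ otherwise, where $T^-(x)=\beta x+\alpha$ for $x\le p$ and $T^-(x)=\beta x+\alpha-1$ for $x>p$. Let $\Omega_{\beta,\alpha}=\tau^+([0,1))\cup\tau^-((0,1])$. A subshift is a closed set $\Omega$ of one-sided sequences over a finite alphabet which is mapped into itself by the left shift; let $\Omega^*$ be the set of finite initial words of elements of $\Omega$. The subshift $\Omega$ is of finite type if there is an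 integer $M\ge1$ such that, for all $\omega_1\cdots\omega_n,\ \zeta_1\cdots\zeta_m\in\Omega^*$ with $n\ge M$ and $m\ge1$, one has $\omega_{n-M+1}\cdots\omega_n\zeta_1\cdots\zeta_m\in\Omega^*$ if and only if $\omega_1\cdots\omega_n\zeta_1\cdots\zeta_m\in\Omega^*$. Let $a,\gamma\in(0,1)$ and $S\subseteq[0,1]$. In the $(a,\gamma)$-game Player 2 chooses a closed interval $B_1\subseteq[0,1]$ of positive length, and then Player 1 and Player 2 alternately choose closed intervals $B_1\supseteq W_1\supseteq B_2\supseteq W_2\supseteq\cdots$, Player 1 the $W_n$ with $|W_n|=a|B_n|$ and Player 2 the $B_{n+1}$ with $|B_{n+1}|=\gamma|W_n|$. The set $S$ is $(a,\gamma)$-winning if Player 1 has a strategy which ensures that $\bigcap_n W_n\subseteq S$ however Player 2 plays, and $S$ is winning if there is an $a\in(0,1)$ such that $S$ is $(a,\gamma)$-winning for every $\gamma\in(0,1)$. **Theorem.** Let $(\beta,\alpha)\in\Delta$ be such that $\Omega_{\beta,\alpha}$ is a subshift of finite type, and let $\xi\in[0,1]$. Then the set $$\mathrm{Bad}_{\beta,\alpha}(\xi)=\bigl\{x\in[0,1]:\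 \xi\notin\overline{\{T_{\beta,\alpha}^n(x):\ n\ge0\}}\bigr\}$$ is winning. -/

import Mathlib

open Set Filter Topology

/-! ### Subshifts (sequences are indexed from `0`) -/

/-- The left shift on one-sided sequences. -/
def shift {A : Type*} (ω : ℕ → A) : ℕ → A := fun n => ω (n + 1)

/-- A subshift: a closed set of sequences (for the product of the discrete topologies) that is
mapped into itself by the left shift. -/
def IsSubshift {A : Type*} [TopologicalSpace A] [DiscreteTopology A] (Ω : Set (ℕ → A)) : Prop :=
  IsClosed Ω ∧ ∀ ω ∈ Ω, shift ω ∈ Ω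

/-- The language of `Ω`: all finite words that are an initial segment of an element of `Ω`. -/
def language {A : Type*} (Ω : Set (ℕ → A)) : Set (List A) :=
  {w | ∃ ω ∈ Ω, w = (List.range w.length).map ω}

/-- A subshift is of finite type if for some `M ≥ 1`: for all words `w`, `v` of the language with
`w` of length at least `M` and `v` non-empty, `w v` belongs to the language if and only if
`w' v` does, where `w'` consists of the last `M` letters of `w`. -/
def IsSubshiftOfFiniteType {A : Type*} [TopologicalSpace A] [DiscreteTopology A]
    (Ω : Set (ℕ → A)) : Prop :=
  IsSubshift Ω ∧ ∃ M : ℕ, 1 ≤ M ∧ ∀ w ∈ language Ω, ∀ v ∈ language Ω, M ≤ w.length → v ≠ [] →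
    (w.drop (w.length - M) ++ v ∈ language Ω ↔ w ++ v ∈ language Ω)

/-! ### Intermediate beta-transformations and beta-shifts -/

/-- The parameter set `Δ` of pairs `(β, α)` with `1 < β < 2` and `0 ≤ α ≤ 2 - β`. -/
def paramSet : Set (ℝ × ℝ) := {q | q.1 ∈ Ioo (1 : ℝ) 2 ∧ q.2 ∈ Icc (0 : ℝ) (2 - q.1)}

noncomputable section

/-- The intermediate beta-transformation `x ↦ β x + α mod 1` (it is iterated on `[0, 1]`). -/
def betaMap (β α x : ℝ) : ℝ := Int.fract (β * x + α)

/-- The point `p = (1 - α) / β` of discontinuity. -/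
def critPoint (β α : ℝ) : ℝ := (1 - α) / β

/-- The left-continuous version of the transformation, which takes the value `1` at `p`. -/
def betaMapLower (β α x : ℝ) : ℝ :=
  if x ≤ critPoint β α then β * x + α else β * x + α - 1

/-- The upper expansion of `x`: the letter at `n` is `0` if `T ^ n x < p` and `1` otherwise. -/
def upperExpansion (β α x : ℝ) : ℕ → Fin 2 := fun n =>
  if (betaMap β α)^[n] x < critPoint β α then 0 else 1

/-- The lower expansion of `x`, given by the left-continuous map; for `x` in `(0, 1]` it is the
limit of the upper expansions of `y` as `y` increases to `x`, see `tendsto_upperExpansion`. -/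
def lowerExpansion (β α x : ℝ) : ℕ → Fin 2 := fun n =>
  if (betaMapLower β α)^[n] x ≤ critPoint β α then 0 else 1

/-- The intermediate beta-shift: the upper expansions of the points of `[0, 1)` together with the
lower expansions of the points of `(0, 1]`. -/
def betaShift (β α : ℝ) : Set (ℕ → Fin 2) :=
  upperExpansion β α '' Ico 0 1 ∪ lowerExpansion β α '' Ioc 0 1

/-- The points of `[0, 1]` whose orbit closure does not contain `ξ`. -/
def badSet (β α ξ : ℝ) : Set ℝ :=
  {x | x ∈ Icc (0 : ℝ) 1 ∧ ξ ∉ closure (range fun n : ℕ => (betaMap β α)^[n] x)}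

end

theorem betaMapLower_mem {β α : ℝ} (h : (β, α) ∈ paramSet) {x : ℝ} (hx : x ∈ Ioc (0 : ℝ) 1) :
    betaMapLower β α x ∈ Ioc (0 : ℝ) 1 := by
  obtain ⟨⟨hβ1, hβ2⟩, hα0, hα1⟩ := h
  obtain ⟨hx0, hx1⟩ := hx
  simp only at hβ1 hβ2 hα0 hα1
  have hβ : 0 < β := by linarith
  unfold betaMapLower critPoint
  split_ifs with hp
  · rw [le_div_iff₀ hβ] at hp
    constructor
    · have := mul_pos hβ hx0
      linarith
    · linarith
  · rw [not_le, div_lt_iff₀ hβ] at hp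
    constructor
    · linarith
    · nlinarith

theorem tendsto_betaMap {β α : ℝ} (h : (β, α) ∈ paramSet) {x : ℝ} (hx : x ∈ Ioc (0 : ℝ) 1) :
    Tendsto (betaMap β α) (𝓝[<] x) (𝓝[<] (betaMapLower β α x)) := by
  have hm := betaMapLower_mem h hx
  obtain ⟨⟨hβ1, hβ2⟩, hα0, hα1⟩ := h
  obtain ⟨hx0, hx1⟩ := hx
  simp only at hβ1 hβ2 hα0 hα1
  have hβ : 0 < β := by linarith
  obtain ⟨c, hc, hcz⟩ : ∃ c : ℝ, betaMapLower β α x = β * x + c ∧ ∃ z : ℤ, α - c = z := by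
    unfold betaMapLower
    split_ifs
    · exact ⟨α, rfl, 0, by simp⟩
    · exact ⟨α - 1, by ring, 1, by simp⟩
  obtain ⟨z, hz⟩ := hcz
  rw [hc] at hm ⊢
  have hcont : Tendsto (fun y : ℝ => β * y + c) (𝓝[<] x) (𝓝 (β * x + c)) :=
    ((by fun_prop : Continuous fun y : ℝ => β * y + c).tendsto x).mono_left nhdsWithin_le_nhds
  have hlt : ∀ᶠ y in 𝓝[<] x, β * y + c < β * x + c := by
    filter_upwards [self_mem_nhdsWithin] with y hy
    have := mul_lt_mul_of_pos_left (mem_Iio.1 hy) hβ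
    linarith
  have hpos : ∀ᶠ y in 𝓝[<] x, 0 < β * y + c := hcont.eventually (lt_mem_nhds hm.1)
  refine (tendsto_nhdsWithin_iff.2 ⟨hcont, hlt⟩).congr' ?_
  filter_upwards [hlt, hpos] with y h1 h2
  symm
  exact Int.fract_eq_iff.2 ⟨h2.le, by linarith [hm.2], z, by rw [← hz]; ring⟩

/-- The lower expansion is the left limit of the upper expansions. -/
theorem tendsto_upperExpansion {β α : ℝ} (h : (β, α) ∈ paramSet) {x : ℝ}
    (hx : x ∈ Ioc (0 : ℝ) 1) :
    Tendsto (upperExpansion β α) (𝓝[<] x) (𝓝 (lowerExpansion β α x)) := by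
  have key : ∀ n : ℕ, (betaMapLower β α)^[n] x ∈ Ioc (0 : ℝ) 1 ∧
      Tendsto ((betaMap β α)^[n]) (𝓝[<] x) (𝓝[<] ((betaMapLower β α)^[n] x)) := by
    intro n
    induction n with
    | zero => exact ⟨hx, tendsto_id⟩
    | succ n ih =>
      rw [Function.iterate_succ', Function.iterate_succ']
      exact ⟨betaMapLower_mem h ih.1, (tendsto_betaMap h ih.1).comp ih.2⟩
  refine tendsto_pi_nhds.2 fun n => ?_
  have ht := (key n).2
  refine tendsto_nhds_of_eventually_eq ?_
  unfold upperExpansion lowerExpansion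
  split_ifs with hp
  · filter_upwards [ht.eventually self_mem_nhdsWithin] with y hy
    exact if_pos (lt_of_lt_of_le hy hp)
  · filter_upwards [(ht.mono_right nhdsWithin_le_nhds).eventually (lt_mem_nhds (not_le.1 hp))]
      with y hy
    exact if_neg (not_lt.2 hy.le)

/-! ### Schmidt's game on `[0, 1]`

A move is a compact interval, a term of `NonemptyInterval ℝ`; on this type `≤` is inclusion. -/

/-- The `n`-th move of Player 1 when the moves of Player 2 are `B 0, B 1, …` and Player 1 follows
the strategy `s`, which assigns a move to every list of moves of Player 2 so far. -/
def answer (s : List (NonemptyInterval ℝ) → NonemptyInterval ℝ) (B : ℕ → NonemptyInterval ℝ)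
    (n : ℕ) : NonemptyInterval ℝ :=
  s ((List.range (n + 1)).map B)

/-- `s` is a winning strategy of Player 1 in the `(a, c)`-game with target `S`. Player 2 opens with
an interval of positive length in `[0, 1]`; an answer `W n` of Player 1 has to lie in `B n` and to
have length `a * |B n|`; the next move `B (n + 1)` of Player 2 has to lie in `W n` and to have
length `c * |W n|`. As long as Player 2 obeys the rules, so does `s`; and if Player 2 obeys them
throughout, the intersection of the intervals is contained in `S`. -/
def IsWinningStrategy (a c : ℝ) (S : Set ℝ)
    (s : List (NonemptyInterval ℝ) → NonemptyInterval ℝ) : Prop :=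
  ∀ B : ℕ → NonemptyInterval ℝ, 0 < (B 0).length → (B 0 : Set ℝ) ⊆ Icc 0 1 →
    (∀ n, (∀ k < n, B (k + 1) ≤ answer s B k ∧
        (B (k + 1)).length = c * (answer s B k).length) →
      answer s B n ≤ B n ∧ (answer s B n).length = a * (B n).length) ∧
    ((∀ n, B (n + 1) ≤ answer s B n ∧ (B (n + 1)).length = c * (answer s B n).length) →
      ⋂ n, (answer s B n : Set ℝ) ⊆ S)

/-- `S` is winning: for some `a` in `(0, 1)` and every `c` in `(0, 1)`, Player 1 has a winning
strategy in the `(a, c)`-game with target `S`. -/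
def IsWinning (S : Set ℝ) : Prop :=
  ∃ a ∈ Ioo (0 : ℝ) 1, ∀ c ∈ Ioo (0 : ℝ) 1, ∃ s, IsWinningStrategy a c S s

/-!
Player 1 wins with the ratio `a = 1 / 4`, because the points that the orbit of `x` has to avoid are,
at every scale, well separated.

The symbolic hypothesis enters only through the orbits of the two endpoints. The upper expansion of
`0` and the lower expansion of `1` are the least and the greatest element of the shift, and an
extremal element of a subshift of finite type is eventually periodic
(`IsSubshiftOfFiniteType.exists_tail_eq`). As the maps are expanding, a point is determined by its
expansion, and so the orbit of `0` under `T` and the orbit of `1` under the lower version of `T` are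
finite (`finite_orbit_zero`, `finite_orbit_one`).

Let `markedPoints n` be the set of the points which one of the two versions of `T ^ n` takes into
one of these orbits or to `ξ`. It contains the endpoints of the intervals on which `T ^ n` is
affine, and every point that `T ^ n` takes close to `ξ` is close to a marked point, at the scale
`β ^ (-n)` (`exists_markedPoints_near`). For each `K`, distinct marked points of the orders
`n, …, n + K` have distances `≥ ε β ^ (-n)` where `ε` depends only on `K`: the branches of `T ^ n`
carry the orders `n, …, n + K` to the orders `0, …, K`, where there are finitely many marked points
(`separated_markedPoints`).

So it is enough to stay `≫ β ^ (-n)` away from the marked points of each order `n`. In the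
`(1 / 4, c)`-game, at an interval of length `r`, Player 1 takes care of the orders for which
`β ^ (-n)` lies between `C (c / 4) r` and `C r`. There is a bounded number of them, and if `C` is
large, then their marked points are at least `2 r` apart, whence the left or the right quarter of
the interval is at distance at least `r / 8` from all of them (`isWinning_of_separated`).
-/

/-! ### Extremal sequences of a subshift of finite type -/

theorem map_range_mem_language {A : Type*} {Ω : Set (ℕ → A)} {ω : ℕ → A} (h : ω ∈ Ω) (n : ℕ) :
    (List.range n).map ω ∈ language Ω :=
  ⟨ω, h, by simp⟩

theorem IsSubshift.add_mem {A : Type*} [TopologicalSpace A] [DiscreteTopology A]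
    {Ω : Set (ℕ → A)} (hΩ : IsSubshift Ω) {ω : ℕ → A} (h : ω ∈ Ω) (n : ℕ) :
    (fun i => ω (n + i)) ∈ Ω := by
  induction n with
  | zero => simpa using h
  | succ n ih =>
    have := hΩ.2 _ ih
    convert this using 1
    funext i
    simp only [shift]
    congr 1
    omega

theorem map_range_append {A : Type*} (ω : ℕ → A) (n k : ℕ) :
    (List.range n).map ω ++ (List.range k).map (fun i => ω (n + i)) =
      (List.range (n + k)).map ω := by
  rw [List.range_add, List.map_append, List.map_map]
  rfl

/-- In a subshift of finite type over a finite alphabet, a sequence which is lexicographically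
least with respect to some antisymmetric relation `r` on the alphabet is eventually periodic: if
the same `M` letters follow the positions `n` and `m`, then whatever comes after these letters at
one of the positions may also be placed after them at the other, and minimality forces the two
tails to agree. Taking `≥` for `r` covers the greatest sequences. -/
theorem IsSubshiftOfFiniteType.exists_tail_eq {A : Type*} [Finite A] [TopologicalSpace A]
    [DiscreteTopology A] {Ω : Set (ℕ → A)} (hΩ : IsSubshiftOfFiniteType Ω)
    (r : A → A → Prop) (hanti : ∀ a b, r a b → r b a → a = b)
    {ω : ℕ → A} (hω : ω ∈ Ω)
    (hmin : ∀ ζ ∈ Ω, ∀ N, (∀ i < N, ζ i = ω i) → r (ω N) (ζ N)) :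
    ∃ n m, n < m ∧ ∀ i, ω (n + i) = ω (m + i) := by
  obtain ⟨hsub, M, -, hM⟩ := hΩ
  obtain ⟨n, m, hnm, hw⟩ := Finite.exists_ne_map_eq_of_infinite
    (fun n : ℕ => fun k : Fin M => ω (n + k))
  have hw' : ∀ k < M, ω (n + k) = ω (m + k) := fun k hk => congrFun hw ⟨k, hk⟩
  clear hw
  -- The tail at `n + M` may be transplanted to the position `m + M`.
  have key : ∀ n m : ℕ, (∀ k < M, ω (n + k) = ω (m + k)) → ∀ j,
      (∀ i < j, ω (n + M + i) = ω (m + M + i)) → r (ω (m + M + j)) (ω (n + M + j)) := by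
    intro n m hw j hj
    have hv := map_range_mem_language (hsub.add_mem hω (n + M)) (j + 1)
    have hne : (List.range (j + 1)).map (fun i => ω (n + M + i)) ≠ [] := by simp
    have hdrop : ∀ n, ((List.range (n + M)).map ω).drop
        (((List.range (n + M)).map ω).length - M) = (List.range M).map (fun i => ω (n + i)) := by
      intro n
      rw [← map_range_append, List.drop_left' (by simp)]
    have h1 := (hM _ (map_range_mem_language hω (n + M)) _ hv (by simp) hne).2 (by
      rw [map_range_append]
      exact map_range_mem_language hω _)
    have h2 : (List.range M).map (fun i => ω (n + i)) = (List.range M).map (fun i => ω (m + i)) :=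
      List.map_congr_left fun k hk => hw k (List.mem_range.1 hk)
    rw [hdrop, h2, ← hdrop] at h1
    obtain ⟨ζ, hζ, he⟩ := (hM _ (map_range_mem_language hω (m + M)) _ hv (by simp) hne).1 h1
    have hlen : ((List.range (m + M)).map ω ++
        (List.range (j + 1)).map (fun i => ω (n + M + i))).length = m + M + (j + 1) := by simp
    rw [hlen, ← map_range_append ζ] at he
    obtain ⟨he1, he2⟩ := List.append_inj he (by simp)
    have e1 : ∀ i < m + M, ω i = ζ i := fun i hi =>
      List.map_inj_left.1 he1 i (List.mem_range.2 hi)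
    have e2 : ∀ i < j + 1, ω (n + M + i) = ζ (m + M + i) := fun i hi =>
      List.map_inj_left.1 he2 i (List.mem_range.2 hi)
    rw [e2 j (by omega)]
    refine hmin ζ hζ _ fun i hi => ?_
    rcases lt_or_ge i (m + M) with h | h
    · exact (e1 i h).symm
    · obtain ⟨l, rfl⟩ := Nat.exists_eq_add_of_le h
      rw [← e2 l (by omega), hj l (by omega)]
  have heq : ∀ j, ω (n + M + j) = ω (m + M + j) := by
    intro j
    induction j using Nat.strong_induction_on with
    | _ j ih =>
      exact hanti _ _ (key m n (fun k hk => (hw' k hk).symm) j fun i hi => (ih i hi).symm)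
        (key n m hw' j ih)
  rcases lt_or_gt_of_ne hnm with h | h
  · exact ⟨n + M, m + M, by omega, heq⟩
  · exact ⟨m + M, n + M, by omega, fun i => (heq i).symm⟩

/-! ### Schmidt's game for separated families of points -/

theorem IsWinning.mono {S S' : Set ℝ} (h : S ⊆ S') (hS : IsWinning S) : IsWinning S' := by
  obtain ⟨a, ha, H⟩ := hS
  refine ⟨a, ha, fun c hc => ?_⟩
  obtain ⟨s, hs⟩ := H c hc
  exact ⟨s, fun B h0 h1 => ⟨(hs B h0 h1).1, fun hB => ((hs B h0 h1).2 hB).trans h⟩⟩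

/-- The left quarter of an interval. -/
noncomputable def leftQuarter (I : NonemptyInterval ℝ) : NonemptyInterval ℝ :=
  ⟨(I.fst, I.fst + I.length / 4), by
    have := I.fst_le_snd; simp only [NonemptyInterval.length]; linarith⟩

/-- The right quarter of an interval. -/
noncomputable def rightQuarter (I : NonemptyInterval ℝ) : NonemptyInterval ℝ :=
  ⟨(I.snd - I.length / 4, I.snd), by
    have := I.fst_le_snd; simp only [NonemptyInterval.length]; linarith⟩

open Classical in
/-- The quarter of `I` which is chosen in order to stay away from `U`: the left one, unless some
point of `U` comes within `|I| / 8` of it. -/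
noncomputable def avoidingQuarter (U : Set ℝ) (I : NonemptyInterval ℝ) : NonemptyInterval ℝ :=
  if ∀ x ∈ (leftQuarter I : Set ℝ), ∀ y ∈ U, I.length / 8 ≤ |x - y| then leftQuarter I
  else rightQuarter I

theorem avoidingQuarter_le (U : Set ℝ) (I : NonemptyInterval ℝ) : avoidingQuarter U I ≤ I := by
  have := I.fst_le_snd
  unfold avoidingQuarter
  split_ifs <;> rw [NonemptyInterval.le_def] <;>
    simp only [leftQuarter, rightQuarter, NonemptyInterval.length] <;>
    constructor <;> linarith

theorem length_avoidingQuarter (U : Set ℝ) (I : NonemptyInterval ℝ) :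
    (avoidingQuarter U I).length = 1 / 4 * I.length := by
  unfold avoidingQuarter
  split_ifs <;> simp only [leftQuarter, rightQuarter, NonemptyInterval.length] <;> ring

/-- If the distances between the points of `U` are large compared with `I`, then `U` cannot come
close to both outer quarters of `I`. -/
theorem le_abs_sub_of_mem_avoidingQuarter {U : Set ℝ} {I : NonemptyInterval ℝ}
    (hI : 0 < I.length) (hU : ∀ y ∈ U, ∀ z ∈ U, y < z → 2 * I.length ≤ z - y) {x : ℝ}
    (hx : x ∈ (avoidingQuarter U I : Set ℝ)) {y : ℝ} (hy : y ∈ U) : I.length / 8 ≤ |x - y| := by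
  unfold avoidingQuarter at hx
  split_ifs at hx with h
  · exact h x hx y hy
  · by_contra! hlt
    push Not at h
    obtain ⟨x', hx', z, hz, hlt'⟩ := h
    rw [SetLike.mem_coe, NonemptyInterval.mem_def] at hx hx'
    simp only [leftQuarter, rightQuarter] at hx hx'
    have hl : I.length = I.snd - I.fst := rfl
    rw [abs_lt] at hlt hlt'
    have := hU z hz y hy (by linarith)
    linarith

/-- Let `D n` be sets of reals such that, within any bounded window of orders, distinct points of
`D n, …, D (n + K)` are `≫ β ^ (-n)` apart. Then the set of the points which keep a distance
`≫ β ^ (-n)` from `D n` for all `n` is winning. -/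
theorem isWinning_of_separated {β : ℝ} (hβ : 1 < β) {D : ℕ → Set ℝ}
    (hD : ∀ K : ℕ, ∃ ε > 0, ∀ n i j, n ≤ i → i ≤ n + K → n ≤ j → j ≤ n + K →
      ∀ x ∈ D i, ∀ y ∈ D j, x < y → ε ≤ β ^ n * (y - x)) :
    IsWinning {x | x ∈ Icc (0 : ℝ) 1 ∧ ∃ δ > 0, ∀ n, ∀ y ∈ D n, δ ≤ β ^ n * |x - y|} := by
  refine ⟨1 / 4, by norm_num, fun c hc => ?_⟩
  -- The interval shrinks by the factor `q` in each round.
  obtain ⟨q, hq⟩ : ∃ q, q = 1 / 4 * c := ⟨_, rfl⟩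
  have hq0 : 0 < q := by rw [hq]; linarith [hc.1]
  have hq1 : q < 1 := by rw [hq]; linarith [hc.2]
  obtain ⟨K, hK⟩ := pow_unbounded_of_one_lt (1 / q) hβ
  obtain ⟨ε, hε, hsep⟩ := hD K
  -- At an interval of length `r`, with opening interval of length `r₀`, the answer takes care of
  -- the orders `n` with `C q r < β ^ (-n) ≤ C r`. Large `C` postpones an order until the interval
  -- is short compared with the gaps; `1 ≤ C r₀` leaves out no initial order.
  let C : ℝ → ℝ := fun r₀ => max (2 / (ε * q)) (1 / r₀)
  let U : ℝ → ℝ → Set ℝ := fun r₀ r =>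
    {y | ∃ n, y ∈ D n ∧ C r₀ * q * r * β ^ n < 1 ∧ 1 ≤ C r₀ * r * β ^ n}
  have hβ0 : 0 < β := by linarith
  have hC : ∀ r₀, 0 < C r₀ := fun r₀ => lt_of_lt_of_le (by positivity) (le_max_left _ _)
  have hU : ∀ r₀ r, 0 < r → ∀ y ∈ U r₀ r, ∀ z ∈ U r₀ r, y < z → 2 * r ≤ z - y := by
    rintro r₀ r hr y ⟨i, hyi, hi1, hi2⟩ z ⟨j, hzj, hj1, hj2⟩ hyz
    have hCr := mul_pos (hC r₀) hr
    have close : ∀ i j : ℕ, C r₀ * q * r * β ^ i < 1 → 1 ≤ C r₀ * r * β ^ j → i ≤ j + K := by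
      intro i j hi hj
      by_contra! hlt
      have h1 : β ^ j * β ^ K ≤ β ^ i := by
        rw [← pow_add]; exact pow_le_pow_right₀ hβ.le hlt.le
      have h2 : 1 < q * β ^ K := by
        rw [div_lt_iff₀ hq0] at hK; linarith
      have h3 : C r₀ * q * r * (β ^ j * β ^ K) ≤ C r₀ * q * r * β ^ i :=
        mul_le_mul_of_nonneg_left h1 (by have := hC r₀; positivity)
      nlinarith
    have hn : C r₀ * q * r * β ^ min i j < 1 := by
      rcases min_choice i j with h | h <;> rw [h] <;> assumption
    have h1 := close i j hi1 hj2
    have h2 := close j i hj1 hi2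
    have := hsep (min i j) i j (by omega) (by omega) (by omega) (by omega) y hyi z hzj hyz
    have hC2 : 2 ≤ C r₀ * (ε * q) := by
      rw [← div_le_iff₀ (by positivity)]; exact le_max_left _ _
    have hb : (0 : ℝ) < β ^ min i j := by positivity
    have h4 : 2 * r * β ^ min i j ≤ (z - y) * β ^ min i j := by
      have h5 : 2 * (r * β ^ min i j) ≤ C r₀ * (ε * q) * (r * β ^ min i j) :=
        mul_le_mul_of_nonneg_right hC2 (by positivity)
      nlinarith
    exact le_of_mul_le_mul_right h4 hb
  let s : List (NonemptyInterval ℝ) → NonemptyInterval ℝ := fun L =>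
    avoidingQuarter (U (L.headD default).length (L.getLastD default).length) (L.getLastD default)
  refine ⟨s, fun B hB0 hB1 => ?_⟩
  have hans : ∀ n, answer s B n = avoidingQuarter (U (B 0).length (B n).length) (B n) := by
    intro n
    have h1 : ((List.range (n + 1)).map B).getLastD default = B n := by
      rw [List.range_succ]; simp
    have h2 : ((List.range (n + 1)).map B).headD default = B 0 := by
      rw [List.range_succ_eq_map]; simp
    simp only [answer, s, h1, h2]
  refine ⟨fun n _ => ?_, fun hB x hx => ?_⟩
  · rw [hans]
    exact ⟨avoidingQuarter_le _ _, length_avoidingQuarter _ _⟩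
  · rw [mem_iInter] at hx
    have hlen : ∀ n, (B n).length = (B 0).length * q ^ n := by
      intro n
      induction n with
      | zero => simp
      | succ n ih =>
        rw [(hB n).2, hans, length_avoidingQuarter, ih, hq]; ring
    have hx0 := hx 0
    refine ⟨hB1 ?_, 1 / (8 * C (B 0).length), by have := hC (B 0).length; positivity, ?_⟩
    · rw [hans] at hx0
      exact NonemptyInterval.coe_subset_coe.2 (avoidingQuarter_le _ _) hx0
    intro n y hy
    set r₀ := (B 0).length with hr₀
    have hCp := hC r₀
    have hCr : 1 ≤ C r₀ * r₀ := by
      rw [← div_le_iff₀ hB0]; exact le_max_right _ _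
    have hbn : (1 : ℝ) ≤ β ^ n := one_le_pow₀ hβ.le
    have hpos : 0 < C r₀ * r₀ * β ^ n := by positivity
    obtain ⟨k, hk1, hk2⟩ := exists_nat_pow_near_of_lt_one (x := 1 / (C r₀ * r₀ * β ^ n))
      (by positivity) (by rw [div_le_one hpos]; nlinarith) hq0 hq1
    have hrk : 0 < (B k).length := by rw [hlen]; positivity
    rw [lt_div_iff₀ hpos] at hk1
    rw [div_le_iff₀ hpos] at hk2
    have hyU : y ∈ U r₀ (B k).length := by
      refine ⟨n, hy, ?_, ?_⟩
      · calc _ = q ^ (k + 1) * (C r₀ * r₀ * β ^ n) := by rw [hlen]; ring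
          _ < 1 := hk1
      · calc 1 ≤ q ^ k * (C r₀ * r₀ * β ^ n) := hk2
          _ = _ := by rw [hlen]; ring
    have hxk := hx k
    rw [hans] at hxk
    have hfar := le_abs_sub_of_mem_avoidingQuarter hrk (hU r₀ _ hrk) hxk hyU
    have h2 : 1 ≤ C r₀ * (B k).length * β ^ n := by rw [hlen]; linarith
    rw [div_le_iff₀ (by positivity)]
    have h3 : C r₀ * β ^ n * ((B k).length / 8) ≤ C r₀ * β ^ n * |x - y| :=
      mul_le_mul_of_nonneg_left hfar (by positivity)
    linarith

/-! ### The intermediate beta-transformation and its lower version -/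

theorem critPoint_mem {β α : ℝ} (h : (β, α) ∈ paramSet) : critPoint β α ∈ Ioo (0 : ℝ) 1 := by
  obtain ⟨⟨hβ1, hβ2⟩, hα0, hα1⟩ := h
  simp only at hβ1 hβ2 hα0 hα1
  unfold critPoint
  constructor
  · exact div_pos (by linarith) (by linarith)
  · rw [div_lt_one (by linarith)]; linarith

theorem mul_critPoint {β α : ℝ} (h : (β, α) ∈ paramSet) : β * critPoint β α = 1 - α := by
  have : 0 < β := by linarith [h.1.1]
  unfold critPoint
  field_simp

theorem betaMap_of_lt {β α x : ℝ} (h : (β, α) ∈ paramSet) (hx0 : 0 ≤ x)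
    (hx : x < critPoint β α) : betaMap β α x = β * x + α := by
  have hp := mul_critPoint h
  obtain ⟨⟨hβ1, -⟩, hα0, -⟩ := h
  simp only at hβ1 hα0
  exact Int.fract_eq_self.2 ⟨by positivity, by nlinarith⟩

theorem betaMap_of_ge {β α x : ℝ} (h : (β, α) ∈ paramSet) (hx : critPoint β α ≤ x)
    (hx1 : x < 1) : betaMap β α x = β * x + α - 1 := by
  have hp := mul_critPoint h
  obtain ⟨⟨hβ1, -⟩, -, hα1⟩ := h
  simp only at hβ1 hα1
  exact Int.fract_eq_iff.2 ⟨by nlinarith, by nlinarith, 1, by simp⟩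

theorem betaMap_critPoint {β α : ℝ} (h : (β, α) ∈ paramSet) : betaMap β α (critPoint β α) = 0 := by
  rw [betaMap_of_ge h le_rfl (critPoint_mem h).2, mul_critPoint h]; ring

theorem betaMapLower_critPoint {β α : ℝ} (h : (β, α) ∈ paramSet) :
    betaMapLower β α (critPoint β α) = 1 := by
  rw [betaMapLower, if_pos le_rfl, mul_critPoint h]; ring

theorem betaMap_eq_betaMapLower {β α x : ℝ} (h : (β, α) ∈ paramSet) (hx0 : 0 ≤ x) (hx1 : x < 1)
    (hx : x ≠ critPoint β α) : betaMap β α x = betaMapLower β α x := by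
  unfold betaMapLower
  split_ifs with hp
  · exact betaMap_of_lt h hx0 (lt_of_le_of_ne hp hx)
  · exact betaMap_of_ge h (not_le.1 hp).le hx1

theorem betaMap_mem (β α x : ℝ) : betaMap β α x ∈ Ico (0 : ℝ) 1 :=
  ⟨Int.fract_nonneg _, Int.fract_lt_one _⟩

theorem iterate_betaMap_mem (β α : ℝ) {x : ℝ} (hx : x ∈ Ico (0 : ℝ) 1) (n : ℕ) :
    (betaMap β α)^[n] x ∈ Ico (0 : ℝ) 1 := by
  cases n with
  | zero => exact hx
  | succ n => rw [Function.iterate_succ_apply']; exact betaMap_mem _ _ _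

theorem iterate_betaMapLower_mem {β α : ℝ} (h : (β, α) ∈ paramSet) {x : ℝ}
    (hx : x ∈ Ioc (0 : ℝ) 1) (n : ℕ) : (betaMapLower β α)^[n] x ∈ Ioc (0 : ℝ) 1 := by
  induction n with
  | zero => exact hx
  | succ n ih => rw [Function.iterate_succ_apply']; exact betaMapLower_mem h ih

theorem betaMapLower_mem_Icc {β α : ℝ} (h : (β, α) ∈ paramSet) {x : ℝ}
    (hx : x ∈ Icc (0 : ℝ) 1) : betaMapLower β α x ∈ Icc (0 : ℝ) 1 := by
  rcases hx.1.eq_or_lt with rfl | h0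
  · have hp := critPoint_mem h
    rw [← betaMap_eq_betaMapLower h le_rfl one_pos hp.1.ne]
    exact Ico_subset_Icc_self (betaMap_mem _ _ _)
  · exact Ioc_subset_Icc_self (betaMapLower_mem h ⟨h0, hx.2⟩)

/-! ### Finiteness of the two critical orbits -/

theorem iterate_succ_betaMap {β α : ℝ} (h : (β, α) ∈ paramSet) {x : ℝ} (hx : x ∈ Ico (0 : ℝ) 1)
    (n : ℕ) : (betaMap β α)^[n + 1] x =
      β * (betaMap β α)^[n] x + α - (upperExpansion β α x n : ℕ) := by
  have hm := iterate_betaMap_mem β α hx n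
  rw [Function.iterate_succ_apply']
  unfold upperExpansion
  split_ifs with hp
  · rw [betaMap_of_lt h hm.1 hp]; simp
  · rw [betaMap_of_ge h (not_lt.1 hp) hm.2]; simp

theorem iterate_succ_betaMapLower (β α x : ℝ) (n : ℕ) : (betaMapLower β α)^[n + 1] x =
      β * (betaMapLower β α)^[n] x + α - (lowerExpansion β α x n : ℕ) := by
  rw [Function.iterate_succ_apply']
  unfold lowerExpansion
  rw [betaMapLower]
  split_ifs with hp <;> simp

/-- Two solutions of the recursion `u (n + 1) = β u n + α - ω n` with the same digits `ω` move
apart at the exact rate `β`. -/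
theorem sub_eq_pow_mul {β α : ℝ} {u v : ℕ → ℝ} {ω ζ : ℕ → Fin 2}
    (hu : ∀ n, u (n + 1) = β * u n + α - (ω n : ℕ))
    (hv : ∀ n, v (n + 1) = β * v n + α - (ζ n : ℕ)) {N : ℕ} (h : ∀ i < N, ω i = ζ i) :
    u N - v N = β ^ N * (u 0 - v 0) := by
  induction N with
  | zero => simp
  | succ N ih =>
    rw [hu, hv, h N (by omega), pow_succ', mul_assoc, ← ih fun i hi => h i (by omega)]
    ring

/-- A bounded solution of the recursion `u (n + 1) = β u n + α - ω n` with eventually periodic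
digits has finite range: by expansion it is determined by its digits. -/
theorem finite_range_of_tail_eq {β α : ℝ} (hβ : 1 < β) {u : ℕ → ℝ} {ω : ℕ → Fin 2}
    (hu : ∀ n, u (n + 1) = β * u n + α - (ω n : ℕ)) (hb : ∀ n, u n ∈ Icc (0 : ℝ) 1)
    (hω : ∃ n m, n < m ∧ ∀ i, ω (n + i) = ω (m + i)) : (range u).Finite := by
  obtain ⟨n, m, hnm, hω⟩ := hω
  have hz : ∀ N, u (n + N) - u (m + N) = β ^ N * (u n - u m) := fun N =>
    sub_eq_pow_mul (u := fun i => u (n + i)) (v := fun i => u (m + i)) (fun i => hu (n + i))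
      (fun i => hu (m + i)) (N := N) fun i _ => hω i
  have heq : u n = u m := by
    by_contra hne
    have hpos : 0 < |u n - u m| := abs_pos.2 (sub_ne_zero.2 hne)
    obtain ⟨N, hN⟩ := pow_unbounded_of_one_lt (1 / |u n - u m|) hβ
    have h1 : |u (n + N) - u (m + N)| ≤ 1 := by
      rw [abs_le]
      have h1 := hb (n + N)
      have h2 := hb (m + N)
      constructor <;> linarith [h1.1, h1.2, h2.1, h2.2]
    rw [hz, abs_mul, abs_of_pos (by positivity)] at h1
    rw [div_lt_iff₀ hpos] at hN
    linarith
  have hper : ∀ N, u (n + N) = u (m + N) := fun N => by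
    have := hz N
    rw [heq, sub_self, mul_zero] at this
    linarith
  refine ((Set.finite_Iio m).image u).subset ?_
  rintro _ ⟨k, rfl⟩
  induction k using Nat.strong_induction_on with
  | _ k ih =>
    rcases lt_or_ge k m with h | h
    · exact ⟨k, h, rfl⟩
    · obtain ⟨N, rfl⟩ := Nat.exists_eq_add_of_le h
      have := ih (n + N) (by omega)
      rwa [hper] at this

/-- The upper expansion of `0` is the least element of the shift. -/
theorem upperExpansion_zero_le {β α : ℝ} (h : (β, α) ∈ paramSet) {ζ : ℕ → Fin 2}
    (hζ : ζ ∈ betaShift β α) {N : ℕ} (hN : ∀ i < N, ζ i = upperExpansion β α 0 i) :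
    upperExpansion β α 0 N ≤ ζ N := by
  have hβ : 0 < β := by linarith [h.1.1]
  have h0 := iterate_succ_betaMap h (x := 0) (by simp)
  rcases hζ with ⟨x, hx, rfl⟩ | ⟨x, hx, rfl⟩
  · have := sub_eq_pow_mul (u := fun n => (betaMap β α)^[n] x)
      (v := fun n => (betaMap β α)^[n] 0) (iterate_succ_betaMap h hx) h0 hN
    simp only [Function.iterate_zero, id_eq, sub_zero] at this
    have hpos : 0 ≤ β ^ N * x := mul_nonneg (by positivity) hx.1
    unfold upperExpansion
    split_ifs <;> first | (exfalso; linarith) | simp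
  · have := sub_eq_pow_mul (u := fun n => (betaMapLower β α)^[n] x)
      (v := fun n => (betaMap β α)^[n] 0) (iterate_succ_betaMapLower β α x) h0 hN
    simp only [Function.iterate_zero, id_eq, sub_zero] at this
    have hpos : 0 < β ^ N * x := mul_pos (by positivity) hx.1
    unfold upperExpansion lowerExpansion
    split_ifs <;> first | (exfalso; linarith) | simp

/-- The lower expansion of `1` is the greatest element of the shift. -/
theorem le_lowerExpansion_one {β α : ℝ} (h : (β, α) ∈ paramSet) {ζ : ℕ → Fin 2}
    (hζ : ζ ∈ betaShift β α) {N : ℕ} (hN : ∀ i < N, ζ i = lowerExpansion β α 1 i) :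
    ζ N ≤ lowerExpansion β α 1 N := by
  have hβ : 0 < β := by linarith [h.1.1]
  have h1 := iterate_succ_betaMapLower β α 1
  rcases hζ with ⟨x, hx, rfl⟩ | ⟨x, hx, rfl⟩
  · have := sub_eq_pow_mul (u := fun n => (betaMap β α)^[n] x)
      (v := fun n => (betaMapLower β α)^[n] 1) (iterate_succ_betaMap h hx) h1 hN
    simp only [Function.iterate_zero, id_eq] at this
    have hpos : 0 < β ^ N * (1 - x) := mul_pos (by positivity) (by linarith [hx.2])
    unfold upperExpansion lowerExpansion
    split_ifs <;> first | (exfalso; linarith) | simp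
  · have := sub_eq_pow_mul (u := fun n => (betaMapLower β α)^[n] x)
      (v := fun n => (betaMapLower β α)^[n] 1) (iterate_succ_betaMapLower β α x) h1 hN
    simp only [Function.iterate_zero, id_eq] at this
    have hpos : 0 ≤ β ^ N * (1 - x) := mul_nonneg (by positivity) (by linarith [hx.2])
    unfold lowerExpansion
    split_ifs <;> first | (exfalso; linarith) | simp

theorem finite_orbit_zero {β α : ℝ} (h : (β, α) ∈ paramSet)
    (hfin : IsSubshiftOfFiniteType (betaShift β α)) :
    (range fun n => (betaMap β α)^[n] 0).Finite :=
  finite_range_of_tail_eq h.1.1 (iterate_succ_betaMap h (by simp))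
    (fun n => Ico_subset_Icc_self (iterate_betaMap_mem β α (by simp) n))
    (hfin.exists_tail_eq (· ≤ ·) (fun _ _ => le_antisymm)
      (Or.inl ⟨0, by simp, rfl⟩) fun _ hζ _ hN => upperExpansion_zero_le h hζ hN)

theorem finite_orbit_one {β α : ℝ} (h : (β, α) ∈ paramSet)
    (hfin : IsSubshiftOfFiniteType (betaShift β α)) :
    (range fun n => (betaMapLower β α)^[n] 1).Finite :=
  finite_range_of_tail_eq h.1.1 (iterate_succ_betaMapLower β α 1)
    (fun n => Ioc_subset_Icc_self (iterate_betaMapLower_mem h (by simp) n))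
    (hfin.exists_tail_eq (· ≥ ·) (fun _ _ h₁ h₂ => le_antisymm h₂ h₁)
      (Or.inr ⟨1, by simp, rfl⟩) fun _ hζ _ hN => le_lowerExpansion_one h hζ hN)

/-! ### Preimages of the critical orbits and of the target point -/

/-- The target point `ξ` together with the orbits of `0` and of `1`, which contain all endpoints
of the images `T ^ n J` of the maximal intervals `J` on which `T ^ n` is affine. -/
def targetSet (β α ξ : ℝ) : Set ℝ :=
  range (fun n => (betaMap β α)^[n] 0) ∪ range (fun n => (betaMapLower β α)^[n] 1) ∪ {ξ}

/-- The points of `[0, 1]` which one of the two versions of `T ^ n` takes into `targetSet`. Among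
them are the endpoints of the intervals on which `T ^ n` is affine. -/
def markedPoints (β α ξ : ℝ) (n : ℕ) : Set ℝ :=
  {x | x ∈ Icc (0 : ℝ) 1 ∧
    ((betaMap β α)^[n] x ∈ targetSet β α ξ ∨ (betaMapLower β α)^[n] x ∈ targetSet β α ξ)}

theorem zero_mem_markedPoints (β α ξ : ℝ) (n : ℕ) : 0 ∈ markedPoints β α ξ n :=
  ⟨by simp, Or.inl (Or.inl (Or.inl ⟨n, rfl⟩))⟩

theorem one_mem_markedPoints (β α ξ : ℝ) (n : ℕ) : 1 ∈ markedPoints β α ξ n :=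
  ⟨by simp, Or.inr (Or.inl (Or.inr ⟨n, rfl⟩))⟩

theorem critPoint_mem_markedPoints {β α : ℝ} (h : (β, α) ∈ paramSet) (ξ : ℝ) (n : ℕ) :
    critPoint β α ∈ markedPoints β α ξ (n + 1) := by
  refine ⟨Ioo_subset_Icc_self (critPoint_mem h), Or.inl ?_⟩
  rw [Function.iterate_succ_apply, betaMap_critPoint h]
  exact Or.inl (Or.inl ⟨n, rfl⟩)

theorem betaMap_mem_markedPoints {β α ξ x : ℝ} (h : (β, α) ∈ paramSet) {n : ℕ}
    (hx : x ∈ markedPoints β α ξ (n + 1)) (hx1 : x < 1) :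
    betaMap β α x ∈ markedPoints β α ξ n := by
  by_cases hp : x = critPoint β α
  · rw [hp, betaMap_critPoint h]
    exact zero_mem_markedPoints _ _ _ _
  · refine ⟨Ico_subset_Icc_self (betaMap_mem _ _ _), ?_⟩
    have := hx.2
    rwa [Function.iterate_succ_apply, Function.iterate_succ_apply,
      ← betaMap_eq_betaMapLower h hx.1.1 hx1 hp] at this

theorem betaMapLower_mem_markedPoints {β α ξ x : ℝ} (h : (β, α) ∈ paramSet) {n : ℕ}
    (hx : x ∈ markedPoints β α ξ (n + 1)) : betaMapLower β α x ∈ markedPoints β α ξ n := by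
  refine ⟨betaMapLower_mem_Icc h hx.1, ?_⟩
  rcases hx.1.2.eq_or_lt with rfl | hx1
  · exact Or.inr (Or.inl (Or.inr ⟨n + 1, rfl⟩))
  by_cases hp : x = critPoint β α
  · rw [hp, betaMapLower_critPoint h]
    exact (one_mem_markedPoints β α ξ n).2
  · have := hx.2
    rwa [Function.iterate_succ_apply, Function.iterate_succ_apply,
      betaMap_eq_betaMapLower h hx.1.1 hx1 hp] at this

theorem mem_markedPoints_succ {β α ξ x : ℝ} (h : (β, α) ∈ paramSet) {n : ℕ}
    (hx : x ∈ Icc (0 : ℝ) 1) (hT : betaMapLower β α x ∈ markedPoints β α ξ n) :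
    x ∈ markedPoints β α ξ (n + 1) := by
  rcases hx.2.eq_or_lt with rfl | hx1
  · exact one_mem_markedPoints _ _ _ _
  by_cases hp : x = critPoint β α
  · rw [hp]
    exact critPoint_mem_markedPoints h ξ n
  · refine ⟨hx, ?_⟩
    have := hT.2
    rwa [← betaMap_eq_betaMapLower h hx.1 hx1 hp, ← Function.iterate_succ_apply,
      betaMap_eq_betaMapLower h hx.1 hx1 hp, ← Function.iterate_succ_apply] at this

theorem finite_markedPoints {β α : ℝ} (h : (β, α) ∈ paramSet)
    (hfin : IsSubshiftOfFiniteType (betaShift β α)) (ξ : ℝ) (n : ℕ) :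
    (markedPoints β α ξ n).Finite := by
  have hβ : β ≠ 0 := by linarith [h.1.1]
  induction n with
  | zero =>
    refine (((finite_orbit_zero h hfin).union (finite_orbit_one h hfin)).union
      (finite_singleton ξ)).subset ?_
    rintro x ⟨-, hx | hx⟩ <;> exact hx
  | succ n ih =>
    refine ((ih.image fun y => (y - α) / β).union (ih.image fun y => (y + 1 - α) / β)).subset ?_
    intro x hx
    have hy := betaMapLower_mem_markedPoints h hx
    by_cases hp : x ≤ critPoint β α
    · refine Or.inl ⟨_, hy, ?_⟩
      rw [betaMapLower, if_pos hp]; field_simp; ring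
    · refine Or.inr ⟨_, hy, ?_⟩
      rw [betaMapLower, if_neg hp]; field_simp; ring

theorem exists_pos_le_sub_of_finite {S : Set ℝ} (hS : S.Finite) :
    ∃ ε > 0, ∀ x ∈ S, ∀ y ∈ S, x < y → ε ≤ y - x := by
  rcases S.subsingleton_or_nontrivial with h | h
  · exact ⟨1, one_pos, fun x hx y hy hxy => absurd (h hx hy) hxy.ne⟩
  · refine ⟨S.infsep, (Set.Finite.infsep_pos_iff_nontrivial hS).2 h, fun x hx y hy hxy => ?_⟩
    have := Set.infsep_le_dist_of_mem hx hy hxy.ne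
    rwa [dist_comm, Real.dist_eq, abs_of_pos (sub_pos.2 hxy)] at this

/-- Distinct marked points of orders in the window `n, …, n + K` are `≫ β ^ (-n)` apart. For
`n = 0` these are finitely many points. For `n + 1`, if `p` lies strictly between the two points it
may replace the right one, and otherwise the transformation is affine between them and leads back
to the window of `n`. -/
theorem separated_markedPoints {β α : ℝ} (h : (β, α) ∈ paramSet)
    (hfin : IsSubshiftOfFiniteType (betaShift β α)) (ξ : ℝ) (K : ℕ) :
    ∃ ε > 0, ∀ n i j, n ≤ i → i ≤ n + K → n ≤ j → j ≤ n + K →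
      ∀ x ∈ markedPoints β α ξ i, ∀ y ∈ markedPoints β α ξ j, x < y → ε ≤ β ^ n * (y - x) := by
  have hβ : 0 < β := by linarith [h.1.1]
  obtain ⟨ε, hε, H⟩ := exists_pos_le_sub_of_finite
    ((finite_Iic K).biUnion fun i _ => finite_markedPoints h hfin ξ i)
  refine ⟨ε, hε, fun n => ?_⟩
  induction n with
  | zero =>
    intro i j _ hi _ hj x hx y hy hxy
    rw [pow_zero, one_mul]
    rw [zero_add] at hi hj
    exact H x (mem_biUnion (mem_Iic.2 hi) hx) y (mem_biUnion (mem_Iic.2 hj) hy) hxy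
  | succ n ih =>
    have same_branch : ∀ i j, n ≤ i → i ≤ n + K → n ≤ j → j ≤ n + K →
        ∀ x ∈ markedPoints β α ξ (i + 1), ∀ y ∈ markedPoints β α ξ (j + 1), x < y →
        (y ≤ critPoint β α ∨ critPoint β α ≤ x) → ε ≤ β ^ (n + 1) * (y - x) := by
      intro i j hi1 hi2 hj1 hj2 x hx y hy hxy hp
      have hx1 : x < 1 := hxy.trans_le hy.1.2
      have hsub : betaMapLower β α y - betaMap β α x = β * (y - x) := by
        rcases hp with hp | hp
        · rw [betaMapLower, if_pos hp, betaMap_of_lt h hx.1.1 (hxy.trans_le hp)]; ring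
        · rw [betaMapLower, if_neg (not_le.2 (hp.trans_lt hxy)), betaMap_of_ge h hp hx1]; ring
      have := ih i j hi1 hi2 hj1 hj2 _ (betaMap_mem_markedPoints h hx hx1) _
        (betaMapLower_mem_markedPoints h hy)
        (by have := mul_pos hβ (sub_pos.2 hxy); linarith)
      rwa [hsub, ← mul_assoc, ← pow_succ] at this
    intro i j hi1 hi2 hj1 hj2 x hx y hy hxy
    obtain ⟨i, rfl⟩ : ∃ k, i = k + 1 := ⟨i - 1, by omega⟩
    obtain ⟨j, rfl⟩ : ∃ k, j = k + 1 := ⟨j - 1, by omega⟩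
    by_cases hp : y ≤ critPoint β α ∨ critPoint β α ≤ x
    · exact same_branch i j (by omega) (by omega) (by omega) (by omega) x hx y hy hxy hp
    · push Not at hp
      refine (same_branch i j (by omega) (by omega) (by omega) (by omega) x hx _
        (critPoint_mem_markedPoints h ξ j) hp.2 (Or.inl le_rfl)).trans ?_
      have := hp.1.le
      gcongr

/-- If `T ^ n` takes `x` close to `ξ`, then `x` is close to a marked point of order `n`: pull the
marked point near `T x` back along the branch at `x`; if that leaves the domain of the branch, then
the endpoint of the domain that was passed is a marked point closer to `x`. -/
theorem exists_markedPoints_near {β α : ℝ} (h : (β, α) ∈ paramSet) {ξ : ℝ}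
    (hξ : ξ ∈ Icc (0 : ℝ) 1) {δ : ℝ} (n : ℕ) {x : ℝ} (hx : x ∈ Icc (0 : ℝ) 1)
    (hn : |(betaMap β α)^[n] x - ξ| < δ) :
    ∃ y ∈ markedPoints β α ξ n, β ^ n * |x - y| < δ := by
  have hβ : 0 < β := by linarith [h.1.1]
  have hδ : 0 < δ := (abs_nonneg _).trans_lt hn
  induction n generalizing x with
  | zero => exact ⟨ξ, ⟨hξ, Or.inl (Or.inr rfl)⟩, by simpa using hn⟩
  | succ n ih =>
    rcases hx.2.eq_or_lt with rfl | hx1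
    · exact ⟨1, one_mem_markedPoints _ _ _ _, by simpa using hδ⟩
    rw [Function.iterate_succ_apply] at hn
    obtain ⟨y, hy, hlt⟩ := ih (Ico_subset_Icc_self (betaMap_mem β α x)) hn
    have hp := critPoint_mem h
    have hbp := mul_critPoint h
    -- It is enough to find a marked point between `x` and the pull-back `z` of `y`.
    have reduce : ∀ z, betaMap β α x - y = β * (x - z) →
        (∃ w ∈ markedPoints β α ξ (n + 1), |x - w| ≤ |x - z|) →
        ∃ w ∈ markedPoints β α ξ (n + 1), β ^ (n + 1) * |x - w| < δ := by
      rintro z hz ⟨w, hw, hwz⟩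
      refine ⟨w, hw, lt_of_le_of_lt ?_ hlt⟩
      rw [hz, abs_mul, abs_of_pos hβ, ← mul_assoc, ← pow_succ]
      gcongr
    rcases lt_or_ge x (critPoint β α) with hxp | hxp
    · obtain ⟨z, hz⟩ : ∃ z, z = (y - α) / β := ⟨_, rfl⟩
      have hbz : β * z = y - α := by rw [hz]; field_simp
      refine reduce z (by rw [betaMap_of_lt h hx.1 hxp]; linarith) ?_
      rcases lt_or_ge z 0 with hz0 | hz0
      · refine ⟨0, zero_mem_markedPoints _ _ _ _, ?_⟩
        rw [abs_of_nonneg (by linarith [hx.1]), abs_of_nonneg (by linarith [hx.1])]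
        linarith
      rcases lt_or_ge (critPoint β α) z with hzp | hzp
      · refine ⟨_, critPoint_mem_markedPoints h ξ n, ?_⟩
        rw [abs_of_nonpos (by linarith), abs_of_nonpos (by linarith)]
        linarith
      · refine ⟨z, mem_markedPoints_succ h ⟨hz0, hzp.trans hp.2.le⟩ ?_, le_rfl⟩
        rw [betaMapLower, if_pos hzp, hbz]
        simpa using hy
    · obtain ⟨z, hz⟩ : ∃ z, z = (y + 1 - α) / β := ⟨_, rfl⟩
      have hbz : β * z = y + 1 - α := by rw [hz]; field_simp
      refine reduce z (by rw [betaMap_of_ge h hxp hx1]; linarith) ?_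
      have hzp : critPoint β α ≤ z := by
        refine le_of_mul_le_mul_left ?_ hβ
        rw [hbz, hbp]; linarith [hy.1.1]
      rcases lt_or_ge 1 z with hz1 | hz1
      · refine ⟨1, one_mem_markedPoints _ _ _ _, ?_⟩
        rw [abs_of_nonpos (by linarith), abs_of_nonpos (by linarith)]
        linarith
      rcases hzp.eq_or_lt with hzp | hzp
      · exact ⟨z, hzp ▸ critPoint_mem_markedPoints h ξ n, le_rfl⟩
      · refine ⟨z, mem_markedPoints_succ h ⟨by linarith [hp.1], hz1⟩ ?_, le_rfl⟩
        rw [betaMapLower, if_neg (not_le.2 hzp), hbz]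
        convert hy using 1
        ring

theorem theorem1p6 (β α : ℝ) (hΔ : (β, α) ∈ paramSet)
    (hfin : IsSubshiftOfFiniteType (betaShift β α))
    (ξ : ℝ) (hξ : ξ ∈ Set.Icc (0 : ℝ) 1) :
    IsWinning (badSet β α ξ) := by
  refine IsWinning.mono ?_
    (isWinning_of_separated hΔ.1.1 (separated_markedPoints hΔ hfin ξ))
  rintro x ⟨hx, δ, hδ, hfar⟩
  refine ⟨hx, fun hcl => ?_⟩
  obtain ⟨_, ⟨n, rfl⟩, hn⟩ := Metric.mem_closure_iff.1 hcl δ hδ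
  rw [dist_comm, Real.dist_eq] at hn
  obtain ⟨y, hy, hlt⟩ := exists_markedPoints_near hΔ hξ n hx hn
  exact (hfar n y hy).not_gt hlt
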